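/- All graphs are finite and simple (the graph with no vertices is allowed), $K_1$ is the graph with a single vertex, $\overline G$ is the complement of $G$ and $G\sqcup H$ the disjoint union. The strong product $G\boxtimes H$ has vertex set $V(G)\times V(H)$, and $(g,h)$ is adjacent to a different vertex $(g',h')$ iff ($g=g'$ or $\{g,g'\}\in E(G)$) and ($h=h'$ or $\{h,h'\}\in E(H)$); $G^{\boxtimes N}$ denotes the $N$-fold strong power, with $G^{\boxtimes 0}=K_1$. Let $\alpha(G)$ be the independence number and $\Theta(G)=\lim_{N\to\infty}\alpha(G^{\boxtimes N})^{1/N}$ the Shannon capacity (this limit exists). Write $G\leqslant H$ if there is a graph homomorphism $\overline G\to\overline H$, and write $G\lesssim H$ if there is a sequence $(x_N)_{N\in\mathbb N}$ of natural numbers with $x_N^{1/N}\to 1$ as $N\to\infty$ such that, for every $N\in\mathbb N$, $G^{\boxtimes N}\leqslant (H^{\boxtimes N})^{\sqcup x_N}$, the disjoint union of $x_N$ copies of $H^{\boxtimes N}$. **Theorem 1.1.** Let $S$ be a collection of graphs that is closed under disjoint union $\sqcup$ and strong product $\boxtimes$ and contains $K_1$. Let $\mathbf X(S)$ be the set of all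 maps $\phi:S\to\mathbb R_{\ge 0}$ such that for all $G,H\in S$: 1. if $G\leqslant H$, then $\phi(G)\le\phi(H)$; 2. $\phi(G\sqcup H)=\phi(G)+\phi(H)$; 3. $\phi(G\boxtimes H)=\phi(G)\,\phi(H)$; 4. $\phi(K_1)=1$. Then for all $G,H\in S$: (i) $G\lesssim H$ if and only if $\phi(G)\le\phi(H)$ for all $\phi\in\mathbf X(S)$; (ii) $\Theta(G)=\min_{\phi\in\mathbf X(S)}\phi(G)$; in particular $\mathbf X(S)$ is non-empty and the minimum is attained. -/

import Mathlib

open Filter Topology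
open scoped NNReal

universe u

/-- A finite simple graph. The vertex set may be empty. -/
structure FinGraph : Type (u + 1) where
  /-- the vertex set -/
  V : Type u
  [finite : Finite V]
  /-- the adjacency relation -/
  graph : SimpleGraph V

namespace FinGraph

attribute [instance] FinGraph.finite

/-- The strong product `G ⊠ H`: distinct pairs are adjacent iff in each coordinate
they are adjacent or equal. -/
def strongProd (G H : FinGraph.{u}) : FinGraph.{u} where
  V := G.V × H.V
  graph :=
    { Adj := fun x y =>
        (G.graph.Adj x.1 y.1 ∧ H.graph.Adj x.2 y.2) ∨
        (G.graph.Adj x.1 y.1 ∧ x.2 = y.2) ∨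
        (x.1 = y.1 ∧ H.graph.Adj x.2 y.2)
      symm := ⟨fun x y h => by
        rcases h with ⟨h₁, h₂⟩ | ⟨h₁, h₂⟩ | ⟨h₁, h₂⟩
        · exact Or.inl ⟨h₁.symm, h₂.symm⟩
        · exact Or.inr (Or.inl ⟨h₁.symm, h₂.symm⟩)
        · exact Or.inr (Or.inr ⟨h₁.symm, h₂.symm⟩)⟩
      loopless := ⟨fun x h => by
        rcases h with ⟨h₁, _⟩ | ⟨h₁, _⟩ | ⟨_, h₂⟩
        · exact h₁.ne rfl
        · exact h₁.ne rfl
        · exact h₂.ne rfl⟩ }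

/-- The disjoint union `G ⊔ H`. -/
def disjUnion (G H : FinGraph.{u}) : FinGraph.{u} where
  V := G.V ⊕ H.V
  graph := G.graph ⊕g H.graph

/-- The complete graph `K n` on `n` vertices. -/
def K (n : ℕ) : FinGraph.{u} where
  V := ULift.{u} (Fin n)
  graph := ⊤

/-- The `N`-fold strong power, with `G ^ 0 = K 1`. -/
def strongPow (G : FinGraph.{u}) : ℕ → FinGraph.{u}
  | 0 => K 1
  | N + 1 => strongProd (strongPow G N) G

/-- The disjoint union of `n` copies of `G`; zero copies give the empty graph `K 0`. -/
def copies (G : FinGraph.{u}) : ℕ → FinGraph.{u}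
  | 0 => K 0
  | n + 1 => disjUnion (copies G n) G

/-- `G ≤ H`: there is a graph homomorphism from the complement of `G` to the
complement of `H`. -/
def CohomLE (G H : FinGraph.{u}) : Prop :=
  Nonempty (G.graphᶜ →g H.graphᶜ)

/-- The asymptotic preorder `G ≲ H`. -/
def AsympLE (G H : FinGraph.{u}) : Prop :=
  ∃ x : ℕ → ℕ,
    Tendsto (fun N : ℕ => (x N : ℝ) ^ ((1 : ℝ) / (N : ℝ))) atTop (𝓝 1) ∧
    ∀ N : ℕ, CohomLE (G.strongPow N) ((H.strongPow N).copies (x N))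

/-- The sequence `α(G ^ N) ^ (1 / N)`, where `α` is the independence number. -/
noncomputable def capacitySeq (G : FinGraph.{u}) (N : ℕ) : ℝ :=
  ((G.strongPow N).graph.indepNum : ℝ) ^ ((1 : ℝ) / (N : ℝ))

/-- The Shannon capacity `Θ(G)`, the limit of `α(G ^ N) ^ (1 / N)`. -/
noncomputable def shannonCapacity (G : FinGraph.{u}) : ℝ :=
  limUnder atTop G.capacitySeq

/-- A collection of graphs that is closed under disjoint union and strong product and
contains `K 1`. -/
structure IsClosedCollection (S : Set FinGraph.{u}) : Prop where
  disjUnion_mem : ∀ {G H : FinGraph.{u}}, G ∈ S → H ∈ S → disjUnion G H ∈ S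
  strongProd_mem : ∀ {G H : FinGraph.{u}}, G ∈ S → H ∈ S → strongProd G H ∈ S
  K_one_mem : K 1 ∈ S

/-- The asymptotic spectrum `X(S)`. -/
def asymptoticSpectrum (S : Set FinGraph.{u}) (hS : IsClosedCollection S) : Set (S → ℝ≥0) :=
  {φ | (∀ G H : S, CohomLE G.1 H.1 → φ G ≤ φ H) ∧
       (∀ G H : S, φ ⟨disjUnion G.1 H.1, hS.disjUnion_mem G.2 H.2⟩ = φ G + φ H) ∧
       (∀ G H : S, φ ⟨strongProd G.1 H.1, hS.strongProd_mem G.2 H.2⟩ = φ G * φ H) ∧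
       φ ⟨K 1, hS.K_one_mem⟩ = 1}

end FinGraph

/-! This is Strassen's duality applied to graphs. Modulo cohomomorphic equivalence, graphs under
disjoint union and strong product form an ordered commutative semiring in which the natural number
`n` is the edgeless graph on `n` vertices. Thus `α(G)` is the largest `n` with `n ≤ G`, and elements
of the spectrum are monotone semiring homomorphisms to the reals. Everything but this translation
takes place in an abstract `GraphLikeSemiring`.

Zorn's lemma extends a compatible preorder that keeps the naturals apart to a maximal one. A maximal
one is total (`total_of_maximal`), and comparing multiples of an element with naturals then defines
a homomorphism (`value_isSpectralPoint`). Hence if `f x < f y` at every spectral point, the relation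
`y ≤ x` cannot be adjoined consistently, and this obstruction is an inequality `1 + m + s * x ≤ m +
s * y` (`exists_separating_multiplier`). Iterating it and taking powers bounds powers of `x` by
those of `y`.

For (i), this is applied to `j * a` and `(j + 1) * b`; the loss per factor tends to 1 as `j` grows.
For (ii), compactness provides a spectral point `f` minimizing `f a`. By (i), `⌊f a ^ N⌋` is
asymptotically below `a ^ N`, and the subexponential factor is absorbed into few extra powers of
`a`, so the minimum does not exceed the capacity. -/

set_option linter.unusedSectionVars false

/-! ### Graph-like ordered semirings -/

/-- An ordered commutative semiring with the features of the semiring of finite graphs. -/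
class GraphLikeSemiring (A : Type*) [CommSemiring A] [PartialOrder A] : Prop where
  add_le_add_left' : ∀ {a b : A}, a ≤ b → ∀ c, c + a ≤ c + b
  mul_le_mul_left' : ∀ {a b : A}, a ≤ b → ∀ c, c * a ≤ c * b
  zero_le' : ∀ a : A, 0 ≤ a
  exists_le_natCast : ∀ a : A, ∃ n : ℕ, a ≤ n
  one_le_of_ne_zero : ∀ {a : A}, a ≠ 0 → 1 ≤ a
  le_of_natCast_le : ∀ {m n : ℕ}, (m : A) ≤ n → m ≤ n
  le_one_or_two_le : ∀ a : A, a ≤ 1 ∨ 2 ≤ a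

namespace GraphLikeSemiring

variable {A : Type*} [CommSemiring A] [PartialOrder A] [GraphLikeSemiring A]

instance : AddLeftMono A := ⟨fun c _ _ h => add_le_add_left' h c⟩

instance : AddRightMono A := ⟨fun c a b h => by
  simpa only [Function.swap, add_comm _ c] using add_le_add_left' h c⟩

instance : MulLeftMono A := ⟨fun c _ _ h => mul_le_mul_left' h c⟩

instance : MulRightMono A := ⟨fun c a b h => by
  simpa only [Function.swap, mul_comm _ c] using mul_le_mul_left' h c⟩

instance : ZeroLEOneClass A := ⟨zero_le' 1⟩

theorem natCast_le_natCast {m n : ℕ} (h : m ≤ n) : (m : A) ≤ n := by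
  obtain ⟨k, rfl⟩ := Nat.exists_eq_add_of_le h
  push_cast
  exact le_add_of_nonneg_right (zero_le' _)

theorem not_one_le_zero : ¬ (1 : A) ≤ 0 := fun h => by
  have : ((1 : ℕ) : A) ≤ (0 : ℕ) := by simpa using h
  exact absurd (le_of_natCast_le this) (by norm_num)

theorem ne_zero_of_one_le {a : A} (h : 1 ≤ a) : a ≠ 0 := by
  rintro rfl
  exact not_one_le_zero h

/-! ### Compatible preorders and their maximal extensions -/

/-- A semiring preorder refining `≤` that does not collapse the natural numbers. -/
structure StrassenRel (r : A → A → Prop) : Prop where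
  of_le : ∀ {a b}, a ≤ b → r a b
  trans : ∀ {a b c}, r a b → r b c → r a c
  add_right : ∀ {a b}, r a b → ∀ c, r (a + c) (b + c)
  mul_right : ∀ {a b}, r a b → ∀ c, r (a * c) (b * c)
  natCast : ∀ {m n : ℕ}, r (m : A) n → m ≤ n

theorem strassenRel_le : StrassenRel (fun a b : A => a ≤ b) where
  of_le h := h
  trans := le_trans
  add_right h c := by gcongr
  mul_right h c := by gcongr
  natCast := le_of_natCast_le

namespace StrassenRel

variable {r : A → A → Prop}

theorem add (hr : StrassenRel r) {a b c d : A} (h : r a b) (h' : r c d) :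
    r (a + c) (b + d) :=
  hr.trans (hr.add_right h c) (by simpa only [add_comm b] using hr.add_right h' b)

theorem mul (hr : StrassenRel r) {a b c d : A} (h : r a b) (h' : r c d) :
    r (a * c) (b * d) :=
  hr.trans (hr.mul_right h c) (by simpa only [mul_comm b] using hr.mul_right h' b)

theorem refl (hr : StrassenRel r) (a : A) : r a a := hr.of_le le_rfl

/-- Iteration puts `j * t + w` below `w` for every `j`. A nonzero `t` is at least 1, so every
natural number would lie below a fixed natural bound of `w`. -/
theorem eq_zero_of_add_le_self (hr : StrassenRel r) {t w : A} (h : r (t + w) w) : t = 0 := by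
  by_contra ht
  have iter : ∀ j : ℕ, r (j * t + w) w := by
    intro j
    induction j with
    | zero => simpa using hr.refl w
    | succ j ih =>
      have h1 := hr.add (hr.refl ((j : A) * t)) h
      refine hr.trans ?_ (hr.trans h1 ih)
      exact hr.of_le (le_of_eq (by push_cast; ring))
  obtain ⟨K, hK⟩ := exists_le_natCast w
  have h1 : ((K + 1 : ℕ) : A) ≤ (K + 1 : ℕ) * t + w := by
    calc ((K + 1 : ℕ) : A) = (K + 1 : ℕ) * 1 + 0 := by ring
      _ ≤ _ := by
        gcongr
        · exact one_le_of_ne_zero ht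
        · exact zero_le' w
  have := hr.natCast (hr.trans (hr.of_le h1) (hr.trans (iter (K + 1)) (hr.of_le hK)))
  omega

/-- The preorder generated by `r` and the relation `y ≤ x`. -/
def adjoin (r : A → A → Prop) (x y : A) : A → A → Prop :=
  fun u v => ∃ s, r (u + s * x) (v + s * y)

theorem le_adjoin (r : A → A → Prop) (x y : A) : r ≤ adjoin r x y :=
  fun u v h => ⟨0, by simpa using h⟩

theorem adjoin_self (hr : StrassenRel r) (x y : A) : adjoin r x y y x :=
  ⟨1, hr.of_le (le_of_eq (by ring))⟩

/-- Only the separation of naturals can fail: if `m` falls below a smaller `n`, then `n + 1 ≤ m`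
produces exactly the excluded inequality. -/
theorem adjoin_strassenRel (hr : StrassenRel r) {x y : A}
    (h : ¬ ∃ (s : A) (m : ℕ), r (1 + m + s * x) (m + s * y)) :
    StrassenRel (adjoin r x y) where
  of_le hab := le_adjoin r x y _ _ (hr.of_le hab)
  trans := by
    rintro a b c ⟨s, hs⟩ ⟨t, ht⟩
    refine ⟨s + t, ?_⟩
    have h1 := hr.add_right hs (t * x)
    have h2 := hr.add_right ht (s * y)
    have e1 : a + (s + t) * x = a + s * x + t * x := by ring
    have e2 : c + (s + t) * y = c + t * y + s * y := by ring
    rw [e1, e2]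
    refine hr.trans h1 (hr.trans (hr.of_le (le_of_eq ?_)) h2)
    ring
  add_right := by
    rintro a b ⟨s, hs⟩ c
    refine ⟨s, ?_⟩
    have := hr.add_right hs c
    rwa [add_right_comm, add_right_comm b]
  mul_right := by
    rintro a b ⟨s, hs⟩ c
    refine ⟨s * c, ?_⟩
    have := hr.mul_right hs c
    have e1 : a * c + s * c * x = (a + s * x) * c := by ring
    have e2 : b * c + s * c * y = (b + s * y) * c := by ring
    rwa [e1, e2]
  natCast := by
    rintro m n ⟨s, hs⟩
    by_contra hmn
    refine h ⟨s, n, hr.trans (hr.of_le ?_) hs⟩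
    have : ((n + 1 : ℕ) : A) ≤ m := natCast_le_natCast (by omega)
    push_cast at this
    rw [add_comm (1 : A)]
    gcongr

theorem exists_maximal (hr : StrassenRel r) :
    ∃ R : A → A → Prop, r ≤ R ∧ Maximal StrassenRel R := by
  refine zorn_le_nonempty₀ {R : A → A → Prop | StrassenRel R} ?_ r hr
  intro c hc hchain y hy
  refine ⟨fun a b => ∃ R ∈ c, R a b, ?_, fun R hR a b h => ⟨R, hR, h⟩⟩
  refine ⟨fun h => ⟨y, hy, (hc hy).of_le h⟩, ?_, ?_, ?_, ?_⟩
  · rintro a b d ⟨R, hR, h⟩ ⟨R', hR', h'⟩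
    rcases hchain.total hR hR' with hle | hle
    · exact ⟨R', hR', (hc hR').trans (hle _ _ h) h'⟩
    · exact ⟨R, hR, (hc hR).trans h (hle _ _ h')⟩
  · rintro a b ⟨R, hR, h⟩ d
    exact ⟨R, hR, (hc hR).add_right h d⟩
  · rintro a b ⟨R, hR, h⟩ d
    exact ⟨R, hR, (hc hR).mul_right h d⟩
  · rintro m n ⟨R, hR, h⟩
    exact (hc hR).natCast h

/-- For an incomparable pair neither direction can be adjoined, so each one has an obstruction; the
two obstructions contradict each other. -/
theorem total_of_maximal (hr : Maximal StrassenRel r) (a b : A) : r a b ∨ r b a := by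
  have hR := hr.prop
  by_contra hcon
  push Not at hcon
  have key : ∀ x y : A, ¬ r y x → ∃ (s : A) (m : ℕ), r (1 + m + s * x) (m + s * y) := by
    intro x y hyx
    by_contra h
    exact hyx (hr.le_of_ge (adjoin_strassenRel hR h) (le_adjoin r x y) _ _
      (adjoin_self hR x y))
  obtain ⟨s, m, h⟩ := key a b hcon.2
  obtain ⟨s', m', h'⟩ := key b a hcon.1
  -- Cross-multiplying puts both `s * s' * a` and `s * s' * b` on each side, so the sides differ
  -- exactly by `s + s'`.
  have h1 := hR.add (hR.mul_right h s') (hR.mul_right h' s)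
  have h2 : r ((s + s') + (m * s' + m' * s + s * s' * a + s * s' * b))
      (m * s' + m' * s + s * s' * a + s * s' * b) := by
    convert h1 using 1 <;> ring
  have h3 := hR.eq_zero_of_add_le_self h2
  have hs : s = 0 := by
    apply le_antisymm _ (zero_le' s)
    rw [← h3]
    exact le_add_of_nonneg_right (zero_le' _)
  subst hs
  have h4 : r ((1 + m : ℕ) : A) (m : ℕ) := by simpa using h
  have := hR.natCast h4
  omega

end StrassenRel

/-! ### Spectral points from total preorders -/

/-- A point of the asymptotic spectrum: a monotone homomorphism to the real numbers. -/
structure IsSpectralPoint (f : A → ℝ) : Prop where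
  mono : ∀ a b, a ≤ b → f a ≤ f b
  map_add : ∀ a b, f (a + b) = f a + f b
  map_mul : ∀ a b, f (a * b) = f a * f b
  map_one : f 1 = 1

theorem eq_of_forall_mul_abs_le {p q C : ℝ} (h : ∀ n : ℕ, 1 ≤ n → n * |p - q| ≤ C) :
    p = q := by
  by_contra hne
  have hpos : 0 < |p - q| := abs_pos.2 (sub_ne_zero.2 hne)
  obtain ⟨n, hn⟩ := exists_nat_gt (C / |p - q|)
  rw [div_lt_iff₀ hpos] at hn
  have := h (n + 1) (by omega)
  push_cast at this
  nlinarith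

theorem le_of_forall_mul_le_add {p q C : ℝ} (h : ∀ n : ℕ, 1 ≤ n → n * p ≤ C + n * q) :
    p ≤ q := by
  by_contra! hlt
  have hpos : 0 < p - q := sub_pos.2 hlt
  obtain ⟨n, hn⟩ := exists_nat_gt (C / (p - q))
  rw [div_lt_iff₀ hpos] at hn
  have := h (n + 1) (by omega)
  push_cast at this
  nlinarith

namespace StrassenRel

variable {r : A → A → Prop}

/-- The value at `a` of the spectral point attached to a total preorder. -/
noncomputable def value (r : A → A → Prop) (a : A) : ℝ :=
  sInf {x : ℝ | ∃ p s : ℕ, 1 ≤ s ∧ r (s * a) p ∧ x = p / s}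

theorem bddBelow_value (a : A) :
    BddBelow {x : ℝ | ∃ p s : ℕ, 1 ≤ s ∧ r (s * a) p ∧ x = p / s} := by
  refine ⟨0, ?_⟩
  rintro x ⟨p, s, -, -, rfl⟩
  positivity

theorem value_le {a : A} {p s : ℕ} (h : r (s * a) p) : s * value r a ≤ p := by
  rcases Nat.eq_zero_or_pos s with rfl | hs
  · simp
  have hs' : (0 : ℝ) < s := by exact_mod_cast hs
  rw [mul_comm, ← le_div_iff₀ hs']
  exact csInf_le (bddBelow_value a) ⟨p, s, hs, h, rfl⟩

theorem le_value (hr : StrassenRel r) {a : A} {p s : ℕ} (hs : 1 ≤ s) (h : r p (s * a)) :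
    p ≤ s * value r a := by
  have hs' : (0 : ℝ) < s := by exact_mod_cast hs
  rw [mul_comm, ← div_le_iff₀ hs']
  refine le_csInf ?_ ?_
  · obtain ⟨n, hn⟩ := exists_le_natCast a
    exact ⟨_, n, 1, le_rfl, hr.of_le (by simpa using hn), rfl⟩
  · rintro x ⟨p', s', h1, h2, rfl⟩
    have h1' : (0 : ℝ) < s' := by exact_mod_cast h1
    rw [div_le_div_iff₀ hs' h1']
    have h3 := hr.mul_right h (s' : A)
    have h4 := hr.mul_right h2 (s : A)
    have h5 : r ((p * s' : ℕ) : A) (p' * s : ℕ) := by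
      push_cast
      refine hr.trans h3 (hr.trans (hr.of_le (le_of_eq ?_)) h4)
      ring
    exact_mod_cast hr.natCast h5

theorem exists_floor (hr : StrassenRel r) (htot : ∀ a b, r a b ∨ r b a) (c : A) :
    ∃ p : ℕ, r p c ∧ r c (p + 1 : ℕ) := by
  classical
  have hex : ∃ p : ℕ, r c (p + 1 : ℕ) := by
    obtain ⟨n, hn⟩ := exists_le_natCast c
    exact ⟨n, hr.of_le (hn.trans (natCast_le_natCast (by omega)))⟩
  refine ⟨Nat.find hex, ?_, Nat.find_spec hex⟩
  rcases h : Nat.find hex with _ | p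
  · exact hr.of_le (by simpa using zero_le' c)
  · have := Nat.find_min hex (m := p) (by omega)
    exact (htot _ _).resolve_right this

/-- By totality `s * a` lies between consecutive naturals, which determines `s * value r a` up to 1.
Each identity then holds up to an error that vanishes after division by `s`. -/
theorem value_isSpectralPoint (hr : StrassenRel r) (htot : ∀ a b, r a b ∨ r b a) :
    IsSpectralPoint (value r) ∧ ∀ a b, r a b → value r a ≤ value r b := by
  have hmono : ∀ a b, r a b → value r a ≤ value r b := by
    intro a b hab
    refine le_of_forall_mul_le_add (C := 1) fun s hs => ?_
    obtain ⟨p, hp, hp'⟩ := exists_floor hr htot (s * b)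
    have h1 : r (s * a) (p + 1 : ℕ) := hr.trans (hr.mul (hr.refl _) hab) hp'
    have h2 := value_le h1
    have h3 := le_value hr hs hp
    push_cast at h2
    linarith
  refine ⟨⟨fun a b h => hmono a b (hr.of_le h), ?_, ?_, ?_⟩, hmono⟩
  · intro a b
    refine eq_of_forall_mul_abs_le (C := 2) fun s hs => ?_
    obtain ⟨p, hp, hp'⟩ := exists_floor hr htot (s * a)
    obtain ⟨q, hq, hq'⟩ := exists_floor hr htot (s * b)
    have h1 : r (p + q : ℕ) (s * (a + b)) := by
      push_cast; rw [mul_add]; exact hr.add hp hq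
    have h2 : r (s * (a + b)) (p + 1 + (q + 1) : ℕ) := by
      rw [Nat.cast_add, mul_add]; exact hr.add hp' hq'
    have a1 := le_value hr hs hp
    have a2 := value_le hp'
    have b1 := le_value hr hs hq
    have b2 := value_le hq'
    have c1 := le_value hr hs h1
    have c2 := value_le h2
    push_cast at *
    have hs0 : (0 : ℝ) ≤ s := by positivity
    have habs : |s * (value r (a + b) - (value r a + value r b))| ≤ 2 := by
      rw [abs_le]
      constructor <;> linarith
    rwa [abs_mul, abs_of_nonneg hs0] at habs
  · intro a b
    refine eq_of_forall_mul_abs_le (C := value r a + value r b + 1) fun s hs => ?_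
    obtain ⟨p, hp, hp'⟩ := exists_floor hr htot (s * a)
    obtain ⟨q, hq, hq'⟩ := exists_floor hr htot (s * b)
    -- At scale `s * s` the bounds `p * q` and `(p + 1) * (q + 1)` differ by `p + q + 1`, which is
    -- only linear in `s`; one factor `s` cancels below.
    have e : ((s * s : ℕ) : A) * (a * b) = (s * a) * (s * b) := by push_cast; ring
    have h1 : r (p * q : ℕ) ((s * s : ℕ) * (a * b)) := by
      rw [e]; push_cast; exact hr.mul hp hq
    have h2 : r ((s * s : ℕ) * (a * b)) ((p + 1) * (q + 1) : ℕ) := by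
      rw [e, Nat.cast_mul]; exact hr.mul hp' hq'
    have a1 := le_value hr hs hp
    have a2 := value_le hp'
    have b1 := le_value hr hs hq
    have b2 := value_le hq'
    have c1 := le_value hr (Nat.mul_pos hs hs) h1
    have c2 := value_le h2
    push_cast at *
    have hs0 : (0 : ℝ) < s := by exact_mod_cast hs
    have hp0 : (0 : ℝ) ≤ p := by positivity
    have hq0 : (0 : ℝ) ≤ q := by positivity
    have hs1 : (1 : ℝ) ≤ s := by exact_mod_cast hs
    have l1 : (p : ℝ) * q ≤ (s * value r a) * (s * value r b) :=
      mul_le_mul a1 b1 hq0 (hp0.trans a1)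
    have l2 : (s * value r a) * (s * value r b) ≤ ((p : ℝ) + 1) * (q + 1) :=
      mul_le_mul a2 b2 (hq0.trans b1) (by positivity)
    have habs : |s * (s * (value r (a * b) - value r a * value r b))| ≤ p + q + 1 := by
      rw [abs_le]
      constructor <;> linarith
    rw [abs_mul, abs_mul, abs_of_pos hs0] at habs
    have : s * (s * |value r (a * b) - value r a * value r b|) ≤
        s * (value r a + value r b + 1) := by linarith
    exact le_of_mul_le_mul_left this hs0
  · apply le_antisymm
    · simpa using value_le (r := r) (a := 1) (p := 1) (s := 1) (hr.of_le (by simp))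
    · simpa using le_value hr (a := 1) (p := 1) (s := 1) le_rfl (hr.of_le (by simp))

theorem exists_isSpectralPoint (hr : StrassenRel r) :
    ∃ f : A → ℝ, IsSpectralPoint f ∧ ∀ a b, r a b → f a ≤ f b := by
  obtain ⟨R, hrR, hR⟩ := exists_maximal hr
  obtain ⟨h1, h2⟩ := value_isSpectralPoint hR.prop (total_of_maximal hR)
  exact ⟨value R, h1, fun a b h => h2 a b (hrR a b h)⟩

end StrassenRel

theorem exists_isSpectralPoint : ∃ f : A → ℝ, IsSpectralPoint f :=
  (strassenRel_le.exists_isSpectralPoint).imp fun _ h => h.1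

/-! ### From strict spectral inequalities to inequalities of powers -/

/-- Otherwise `y ≤ x` could be adjoined to the order, and the resulting preorder would have a
spectral point with `f y ≤ f x`. -/
theorem exists_separating_multiplier {x y : A}
    (h : ∀ f : A → ℝ, IsSpectralPoint f → f x < f y) :
    ∃ (s : A) (m : ℕ), 1 + m + s * x ≤ m + s * y := by
  by_contra hcon
  have hr := strassenRel_le (A := A)
  obtain ⟨f, hf, hle⟩ :=
    (StrassenRel.adjoin_strassenRel hr hcon).exists_isSpectralPoint
  exact absurd (h f hf) (not_lt.2 (hle _ _ (StrassenRel.adjoin_self hr x y)))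

theorem one_le_mul' {a b : A} (ha : 1 ≤ a) (hb : 1 ≤ b) : 1 ≤ a * b := by
  calc (1 : A) = 1 * 1 := by ring
    _ ≤ a * b := by gcongr

/-- The constants `S` and `m` do not depend on `l` and `k`: large `k` makes `S` negligible, and
large `l` makes `(l + m) / l` close to 1. -/
theorem pow_le_of_forall_lt {x y : A} (hy : y ≠ 0)
    (h : ∀ f : A → ℝ, IsSpectralPoint f → f x < f y) :
    ∃ S m : ℕ, ∀ l k : ℕ, (l * x) ^ k ≤ S * ((l + m : ℕ) * y) ^ k := by
  obtain ⟨s, m, hs⟩ := exists_separating_multiplier h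
  have hs0 : s ≠ 0 := by
    rintro rfl
    have : ((1 + m : ℕ) : A) ≤ (m : ℕ) := by simpa using hs
    have := le_of_natCast_le this
    omega
  have hs1 : 1 ≤ s := one_le_of_ne_zero hs0
  have hy1 : 1 ≤ y := one_le_of_ne_zero hy
  have iter : ∀ l : ℕ, l * (1 + s * x) + m ≤ l * (s * y) + m := by
    intro l
    induction l with
    | zero => simp
    | succ l ih =>
      calc ((l + 1 : ℕ) : A) * (1 + s * x) + m = (l * (1 + s * x) + m) + (1 + s * x) := by
            push_cast; ring
        _ ≤ (l * (s * y) + m) + (1 + s * x) := by gcongr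
        _ = (1 + m + s * x) + l * (s * y) := by ring
        _ ≤ (m + s * y) + l * (s * y) := by gcongr
        _ = _ := by push_cast; ring
  -- The summand `l * 1` is discarded, the 1 having served to force `s ≠ 0`; the additive `m` is
  -- absorbed into `m * (s * y)` because `1 ≤ s * y`.
  have step : ∀ l : ℕ, s * (l * x) ≤ s * ((l + m : ℕ) * y) := by
    intro l
    calc s * (l * x) = l * (0 + s * x) + 0 := by ring
      _ ≤ l * (1 + s * x) + m := by
        gcongr
        · exact zero_le' _
        · exact zero_le' _
      _ ≤ l * (s * y) + m * 1 := by simpa using iter l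
      _ ≤ l * (s * y) + m * (s * y) := by
        gcongr
        exact one_le_mul' hs1 hy1
      _ = _ := by push_cast; ring
  obtain ⟨S, hS⟩ := exists_le_natCast s
  refine ⟨S, m, fun l k => ?_⟩
  -- The multiplier `s` acts as a catalyst: it is reused for each factor and is paid for only once
  -- at the end, through `1 ≤ s ≤ S`.
  have hpow : s * (l * x) ^ k ≤ s * ((l + m : ℕ) * y) ^ k := by
    induction k with
    | zero => simp
    | succ k ih =>
      calc s * (l * x) ^ (k + 1) = (s * (l * x) ^ k) * (l * x) := by ring
        _ ≤ (s * ((l + m : ℕ) * y) ^ k) * (l * x) := by gcongr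
        _ = ((l + m : ℕ) * y) ^ k * (s * (l * x)) := by ring
        _ ≤ ((l + m : ℕ) * y) ^ k * (s * ((l + m : ℕ) * y)) := by
          gcongr ((l + m : ℕ) * y) ^ k * ?_
          exact step l
        _ = _ := by ring
  calc (l * x) ^ k = 1 * (l * x) ^ k := by ring
    _ ≤ s * (l * x) ^ k := by gcongr
    _ ≤ s * ((l + m : ℕ) * y) ^ k := hpow
    _ ≤ _ := by gcongr

end GraphLikeSemiring

/-! ### Growth rates of sub- and supermultiplicative sequences -/

theorem exp_log_div_eq_rpow {x : ℕ} (hx : 1 ≤ x) (N : ℕ) :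
    Real.exp (Real.log x / N) = (x : ℝ) ^ ((1 : ℝ) / (N : ℝ)) := by
  rw [Real.rpow_def_of_pos (by exact_mod_cast hx)]
  congr 1
  ring

/-- Fekete's lemma for submultiplicative sequences of positive integers. -/
theorem exists_tendsto_of_submultiplicative {x : ℕ → ℕ} (hx : ∀ N, 1 ≤ x N)
    (hmul : ∀ M N, x (M + N) ≤ x M * x N) :
    ∃ L : ℝ, 0 ≤ L ∧ (∀ N : ℕ, N * L ≤ Real.log (x N)) ∧
      Tendsto (fun N : ℕ => (x N : ℝ) ^ ((1 : ℝ) / (N : ℝ))) atTop (𝓝 (Real.exp L)) := by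
  have hpos : ∀ N, (0 : ℝ) < x N := fun N => by exact_mod_cast hx N
  have hlog : ∀ N, 0 ≤ Real.log (x N) := fun N => Real.log_nonneg (by exact_mod_cast hx N)
  have hsub : Subadditive (fun N => Real.log (x N)) := by
    intro M N
    rw [← Real.log_mul (hpos M).ne' (hpos N).ne']
    exact Real.log_le_log (hpos _) (by exact_mod_cast hmul M N)
  have hbdd : BddBelow (Set.range fun N : ℕ => Real.log (x N) / N) := by
    refine ⟨0, ?_⟩
    rintro _ ⟨N, rfl⟩
    exact div_nonneg (hlog N) (Nat.cast_nonneg N)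
  have hlim := hsub.tendsto_lim hbdd
  refine ⟨hsub.lim, ?_, ?_, ?_⟩
  · exact ge_of_tendsto' hlim fun N => div_nonneg (hlog N) (Nat.cast_nonneg N)
  · intro N
    rcases Nat.eq_zero_or_pos N with rfl | hN
    · simpa using hlog 0
    · have := hsub.lim_le_div hbdd hN.ne'
      rwa [le_div_iff₀ (by exact_mod_cast hN), mul_comm] at this
  · refine ((Real.continuous_exp.tendsto _).comp hlim).congr fun N => ?_
    exact exp_log_div_eq_rpow (hx N) N

/-- Fekete's lemma for supermultiplicative sequences of positive integers. -/
theorem exists_tendsto_of_supermultiplicative {x : ℕ → ℕ} {K : ℕ} (hx : ∀ N, 1 ≤ x N)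
    (hK : ∀ N, x N ≤ K ^ N) (hmul : ∀ M N, x M * x N ≤ x (M + N)) :
    ∃ L : ℝ, 0 ≤ L ∧ (∀ N : ℕ, Real.log (x N) ≤ N * L) ∧
      Tendsto (fun N : ℕ => (x N : ℝ) ^ ((1 : ℝ) / (N : ℝ))) atTop (𝓝 (Real.exp L)) := by
  have hpos : ∀ N, (0 : ℝ) < x N := fun N => by exact_mod_cast hx N
  have hlog : ∀ N, 0 ≤ Real.log (x N) := fun N => Real.log_nonneg (by exact_mod_cast hx N)
  have hsub : Subadditive (fun N => -Real.log (x N)) := by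
    intro M N
    have := Real.log_le_log (mul_pos (hpos M) (hpos N))
      (show (x M : ℝ) * x N ≤ x (M + N) by exact_mod_cast hmul M N)
    rw [Real.log_mul (hpos M).ne' (hpos N).ne'] at this
    linarith
  have hlogK : ∀ N : ℕ, Real.log (x N) ≤ N * Real.log K := fun N => by
    rw [← Real.log_pow]
    exact Real.log_le_log (hpos N) (by exact_mod_cast hK N)
  have hbdd : BddBelow (Set.range fun N : ℕ => -Real.log (x N) / N) := by
    refine ⟨-Real.log K, ?_⟩
    rintro _ ⟨N, rfl⟩
    rcases Nat.eq_zero_or_pos N with rfl | hN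
    · simpa using Real.log_natCast_nonneg K
    · have hN' : (0 : ℝ) < N := by exact_mod_cast hN
      rw [le_div_iff₀ hN']
      have := hlogK N
      linarith
  have hlim := hsub.tendsto_lim hbdd
  have hlim' : Tendsto (fun N : ℕ => Real.log (x N) / N) atTop (𝓝 (-hsub.lim)) := by
    refine hlim.neg.congr fun N => ?_
    ring
  refine ⟨-hsub.lim, ?_, ?_, ?_⟩
  · exact ge_of_tendsto' hlim' fun N => div_nonneg (hlog N) (Nat.cast_nonneg N)
  · intro N
    rcases Nat.eq_zero_or_pos N with rfl | hN
    · have h1 : x 0 = 1 := le_antisymm (by simpa using hK 0) (hx 0)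
      simp [h1]
    · have := hsub.lim_le_div hbdd hN.ne'
      rw [le_div_iff₀ (by exact_mod_cast hN)] at this
      linarith
  · refine ((Real.continuous_exp.tendsto _).comp hlim').congr fun N => ?_
    exact exp_log_div_eq_rpow (hx N) N

/-! ### Duality in a graph-like semiring -/

namespace GraphLikeSemiring

variable {A : Type*} [CommSemiring A] [PartialOrder A] [GraphLikeSemiring A]

namespace IsSpectralPoint

variable {f : A → ℝ}

theorem map_zero (hf : IsSpectralPoint f) : f 0 = 0 := by
  have := hf.map_add 0 0
  rw [add_zero] at this
  linarith

theorem nonneg (hf : IsSpectralPoint f) (a : A) : 0 ≤ f a := by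
  rw [← hf.map_zero]
  exact hf.mono _ _ (zero_le' a)

theorem map_natCast (hf : IsSpectralPoint f) (n : ℕ) : f n = n := by
  induction n with
  | zero => simpa using hf.map_zero
  | succ n ih => push_cast; rw [hf.map_add, ih, hf.map_one]

theorem map_pow (hf : IsSpectralPoint f) (a : A) (n : ℕ) : f (a ^ n) = f a ^ n := by
  induction n with
  | zero => simpa using hf.map_one
  | succ n ih => rw [pow_succ, hf.map_mul, ih, pow_succ]

theorem one_le (hf : IsSpectralPoint f) {a : A} (ha : a ≠ 0) : 1 ≤ f a := by
  rw [← hf.map_one]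
  exact hf.mono _ _ (one_le_of_ne_zero ha)

end IsSpectralPoint

/-- The defining conditions are closed under pointwise convergence, and a natural bound of each `a`
confines the set to a product of compact intervals. -/
theorem isCompact_setOf_isSpectralPoint : IsCompact {f : A → ℝ | IsSpectralPoint f} := by
  choose n hn using exists_le_natCast (A := A)
  refine (isCompact_univ_pi fun a => isCompact_Icc (a := (0 : ℝ)) (b := n a)).of_isClosed_subset
    ?_ ?_
  · have : {f : A → ℝ | IsSpectralPoint f} =
        {f | ∀ a b, a ≤ b → f a ≤ f b} ∩ {f | ∀ a b, f (a + b) = f a + f b} ∩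
          {f | ∀ a b, f (a * b) = f a * f b} ∩ {f | f 1 = 1} := by
      ext f
      exact ⟨fun h => ⟨⟨⟨h.1, h.2⟩, h.3⟩, h.4⟩, fun h => ⟨h.1.1.1, h.1.1.2, h.1.2, h.2⟩⟩
    rw [this]
    refine ((IsClosed.inter ?_ ?_).inter ?_).inter ?_
    · simp only [Set.ofPred_forall]
      exact isClosed_iInter fun a => isClosed_iInter fun b => isClosed_iInter fun _ =>
        isClosed_le (continuous_apply a) (continuous_apply b)
    · simp only [Set.ofPred_forall]
      exact isClosed_iInter fun a => isClosed_iInter fun b =>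
        isClosed_eq (continuous_apply _) ((continuous_apply a).add (continuous_apply b))
    · simp only [Set.ofPred_forall]
      exact isClosed_iInter fun a => isClosed_iInter fun b =>
        isClosed_eq (continuous_apply _) ((continuous_apply a).mul (continuous_apply b))
    · exact isClosed_eq (continuous_apply _) continuous_const
  · intro f hf a _
    refine ⟨hf.nonneg a, ?_⟩
    rw [← hf.map_natCast]
    exact hf.mono _ _ (hn a)

theorem one_le_pow' {a : A} (ha : 1 ≤ a) (n : ℕ) : 1 ≤ a ^ n := by
  induction n with
  | zero => simp
  | succ n ih => rw [pow_succ]; exact one_le_mul' ih ha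

theorem pow_le_pow_left' {a b : A} (h : a ≤ b) (n : ℕ) : a ^ n ≤ b ^ n := by
  induction n with
  | zero => simp
  | succ n ih => rw [pow_succ, pow_succ]; gcongr

/-- `b` dominates `a` on large powers up to subexponential factors. -/
def AsympLE (a b : A) : Prop :=
  ∃ x : ℕ → ℕ,
    Tendsto (fun N : ℕ => (x N : ℝ) ^ ((1 : ℝ) / (N : ℝ))) atTop (𝓝 1) ∧
    ∀ N : ℕ, a ^ N ≤ x N * b ^ N

theorem AsympLE.le {a b : A} (h : AsympLE a b) {f : A → ℝ} (hf : IsSpectralPoint f) :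
    f a ≤ f b := by
  obtain ⟨x, hx, hle⟩ := h
  have hlim := hx.mul_const (f b)
  rw [one_mul] at hlim
  refine ge_of_tendsto hlim ?_
  filter_upwards [eventually_ge_atTop 1] with N hN
  have h1 := hf.mono _ _ (hle N)
  rw [hf.map_mul, hf.map_pow, hf.map_pow, hf.map_natCast] at h1
  have hN0 : N ≠ 0 := by omega
  rw [← pow_le_pow_iff_left₀ (hf.nonneg a) (by have := hf.nonneg b; positivity) hN0, mul_pow,
    one_div, Real.rpow_inv_natCast_pow (Nat.cast_nonneg _) hN0]
  exact h1

theorem asympLE_of_le {a b : A} (h : a ≤ b) : AsympLE a b :=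
  ⟨fun _ => 1, by simp, fun N => by simpa using pow_le_pow_left' h N⟩

/-- The factor `u` need not be cancellable in the semiring, so it is carried through the iteration
without growing. -/
theorem natCast_mul_pow_le {u w k : ℕ} {a b : A} (h : u * a ^ k ≤ u * (w * b ^ k)) (M : ℕ) :
    u * a ^ (k * M) ≤ u * (w ^ M * b ^ (k * M)) := by
  induction M with
  | zero => simp
  | succ M ih =>
    calc u * a ^ (k * (M + 1)) = (u * a ^ (k * M)) * a ^ k := by ring
      _ ≤ (u * (w ^ M * b ^ (k * M))) * a ^ k := by gcongr
      _ = (w ^ M * b ^ (k * M)) * (u * a ^ k) := by ring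
      _ ≤ (w ^ M * b ^ (k * M)) * (u * (w * b ^ k)) := by gcongr
      _ = _ := by ring

theorem le_natCast_mul {n : ℕ} (hn : 1 ≤ n) (a : A) : a ≤ n * a := by
  calc a = ((1 : ℕ) : A) * a := by simp
    _ ≤ n * a := by
      gcongr ?_ * a
      exact natCast_le_natCast hn

/-- The least `x N` with `a ^ N ≤ x N * b ^ N` is submultiplicative, so it has an exponential rate
`L ≥ 0`; the strict case, applied to slightly perturbed elements, forces `L ≤ 0`. -/
theorem asympLE_of_forall_le {a b : A} (h : ∀ f : A → ℝ, IsSpectralPoint f → f a ≤ f b) :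
    AsympLE a b := by
  classical
  rcases eq_or_ne a 0 with rfl | ha
  · exact asympLE_of_le (zero_le' b)
  have hb : b ≠ 0 := by
    rintro rfl
    obtain ⟨f, hf⟩ := exists_isSpectralPoint (A := A)
    have := h f hf
    rw [hf.map_zero] at this
    linarith [hf.one_le ha]
  have ha1 := one_le_of_ne_zero ha
  have hb1 := one_le_of_ne_zero hb
  have hex : ∀ N : ℕ, ∃ n : ℕ, a ^ N ≤ n * b ^ N := fun N => by
    obtain ⟨n, hn⟩ := exists_le_natCast (a ^ N)
    refine ⟨n, hn.trans ?_⟩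
    calc (n : A) = n * 1 := by ring
      _ ≤ n * b ^ N := by gcongr; exact one_le_pow' hb1 N
  set x : ℕ → ℕ := fun N => Nat.find (hex N) with hxdef
  have hspec : ∀ N, a ^ N ≤ x N * b ^ N := fun N => Nat.find_spec (hex N)
  have hmin : ∀ N n : ℕ, a ^ N ≤ n * b ^ N → x N ≤ n := fun N n hn => Nat.find_min' (hex N) hn
  have hx1 : ∀ N, 1 ≤ x N := fun N => by
    by_contra h0
    have h0' : x N = 0 := by omega
    have := hspec N
    rw [h0', Nat.cast_zero, zero_mul] at this
    exact not_one_le_zero ((one_le_pow' ha1 N).trans this)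
  have hmul : ∀ M N, x (M + N) ≤ x M * x N := fun M N => hmin _ _ <| by
    calc a ^ (M + N) = a ^ M * a ^ N := by ring
      _ ≤ (x M * b ^ M) * (x N * b ^ N) := by
        gcongr
        · exact hspec M
        · exact hspec N
      _ = _ := by push_cast; ring
  obtain ⟨L, hL0, hL, hlim⟩ := exists_tendsto_of_submultiplicative hx1 hmul
  suffices hL' : L ≤ 0 by
    rw [le_antisymm hL' hL0, Real.exp_zero] at hlim
    exact ⟨x, hlim, hspec⟩
  -- Division by `u` is replaced by the natural number `w ≥ v / u`. After `M` iterations the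
  -- leftover `u` costs only `log u`, negligible against `M`.
  have rate : ∀ {u v k : ℕ}, 1 ≤ u → u * a ^ k ≤ v * b ^ k →
      k * L ≤ Real.log ((v : ℝ) / u + 1) := by
    intro u v k hu huv
    set w := v / u + 1 with hw
    have hvw : v ≤ u * w := (Nat.lt_mul_div_succ v hu).le
    have h1 : u * a ^ k ≤ u * (w * b ^ k) := by
      refine huv.trans ?_
      calc (v : A) * b ^ k ≤ ((u * w : ℕ) : A) * b ^ k := by
            gcongr ?_ * b ^ k
            exact natCast_le_natCast hvw
        _ = _ := by push_cast; ring
    have h2 : k * L ≤ Real.log w := by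
      refine le_of_forall_mul_le_add (C := Real.log u) fun M _ => ?_
      have h3 : x (k * M) ≤ u * w ^ M := by
        refine hmin _ _ ((le_natCast_mul hu _).trans ((natCast_mul_pow_le h1 M).trans ?_))
        exact le_of_eq (by push_cast; ring)
      have h4 := hL (k * M)
      have h5 : Real.log (x (k * M)) ≤ Real.log u + M * Real.log w := by
        rw [← Real.log_pow, ← Real.log_mul (by positivity) (by positivity)]
        exact Real.log_le_log (by exact_mod_cast hx1 _) (by exact_mod_cast h3)
      push_cast at h4
      linarith
    refine h2.trans (Real.log_le_log (by positivity) ?_)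
    rw [hw]
    push_cast
    gcongr
    exact Nat.cast_div_le
  refine le_of_forall_mul_le_add (C := 2) fun j hj => ?_
  rw [mul_zero, add_zero]
  have hj0 : (0 : ℝ) < j := by exact_mod_cast hj
  have hlt : ∀ f : A → ℝ, IsSpectralPoint f → f (j * a) < f ((j + 1 : ℕ) * b) := by
    intro f hf
    rw [hf.map_mul, hf.map_mul, hf.map_natCast, hf.map_natCast]
    push_cast
    nlinarith [h f hf, hf.one_le hb]
  have hne : ((j + 1 : ℕ) : A) * b ≠ 0 := by
    apply ne_zero_of_one_le
    refine one_le_mul' ?_ hb1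
    exact_mod_cast natCast_le_natCast (A := A) (m := 1) (n := j + 1) (by omega)
  obtain ⟨S, m, hSm⟩ := pow_le_of_forall_lt hne hlt
  -- This choice gives `m / l ≤ 1 / j`, hence `ρ ≤ (1 + 1 / j) ^ 2` and finally `j * L ≤ 2`.
  set l := (m + 1) * j with hl
  have hl1 : 1 ≤ l := Nat.mul_pos (by omega) hj
  set ρ : ℝ := ((l + m : ℕ) * (j + 1 : ℕ) : ℝ) / (l * j : ℝ) with hρ
  have hl0 : (0 : ℝ) < l := by exact_mod_cast hl1
  have hρ1 : 1 ≤ ρ := by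
    rw [hρ, le_div_iff₀ (by positivity)]
    push_cast
    nlinarith [(Nat.cast_nonneg m : (0 : ℝ) ≤ m)]
  have hLρ : L ≤ Real.log ρ := by
    refine le_of_forall_mul_le_add (C := Real.log (S + 1)) fun k _ => ?_
    have h1 := hSm l k
    have h2 : (((l * j) ^ k : ℕ) : A) * a ^ k ≤ ((S * ((l + m) * (j + 1)) ^ k : ℕ) : A) * b ^ k := by
      calc (((l * j) ^ k : ℕ) : A) * a ^ k = (l * (j * a)) ^ k := by push_cast; ring
        _ ≤ _ := h1
        _ = S * (((l + m : ℕ) * (j + 1 : ℕ)) * b) ^ k := by rw [mul_assoc]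
        _ = _ := by rw [mul_pow]; push_cast; ring
    have h3 := rate (Nat.pow_pos (Nat.mul_pos hl1 hj)) h2
    refine h3.trans ?_
    rw [← Real.log_pow, ← Real.log_mul (by positivity) (by positivity)]
    refine Real.log_le_log (by positivity) ?_
    have h4 : ((S * ((l + m) * (j + 1)) ^ k : ℕ) : ℝ) / ((l * j) ^ k : ℕ) = S * ρ ^ k := by
      rw [hρ]; push_cast; rw [div_pow]; ring
    rw [h4]
    have := one_le_pow₀ hρ1 (n := k)
    linarith
  have hρ2 : ρ ≤ (1 + 1 / (j : ℝ)) ^ 2 := by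
    have e : ρ = (1 + m / l) * (1 + 1 / (j : ℝ)) := by
      rw [hρ]; push_cast; field_simp
    rw [e, sq]
    gcongr ?_ * _
    gcongr 1 + ?_
    rw [div_le_div_iff₀ hl0 hj0, hl]
    push_cast
    nlinarith
  have h5 : Real.log ρ ≤ 2 * (1 / (j : ℝ)) := by
    calc Real.log ρ ≤ Real.log ((1 + 1 / (j : ℝ)) ^ 2) :=
          Real.log_le_log (by positivity) hρ2
      _ = 2 * Real.log (1 + 1 / (j : ℝ)) := by rw [Real.log_pow]; norm_num
      _ ≤ _ := by
        have := Real.log_le_sub_one_of_pos (x := 1 + 1 / (j : ℝ)) (by positivity)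
        linarith
  calc (j : ℝ) * L ≤ j * (2 * (1 / (j : ℝ))) := by gcongr; exact hLρ.trans h5
    _ = 2 := by field_simp

theorem asympLE_iff {a b : A} :
    AsympLE a b ↔ ∀ f : A → ℝ, IsSpectralPoint f → f a ≤ f b :=
  ⟨fun h _ hf => h.le hf, asympLE_of_forall_le⟩

/-- Monotonicity bounds the capacity by every `f a`. For the converse, a natural number just below
the `N`-th power of the minimum is asymptotically below `a ^ N` by duality. -/
theorem exists_tendsto_isLeast {a : A} {α : ℕ → ℕ}
    (hα : ∀ N n : ℕ, (n : A) ≤ a ^ N ↔ n ≤ α N) :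
    ∃ Θ : ℝ, Tendsto (fun N : ℕ => (α N : ℝ) ^ ((1 : ℝ) / (N : ℝ))) atTop (𝓝 Θ) ∧
      IsLeast ((fun f : A → ℝ => f a) '' {f | IsSpectralPoint f}) Θ := by
  have hspec : ∀ N, (α N : A) ≤ a ^ N := fun N => (hα N _).2 le_rfl
  rcases eq_or_ne a 0 with rfl | ha
  · refine ⟨0, ?_, ?_⟩
    · refine tendsto_const_nhds.congr' ?_
      filter_upwards [eventually_ge_atTop 1] with N hN
      have hN0 : N ≠ 0 := by omega
      have h1 := hspec N
      rw [zero_pow hN0] at h1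
      have h2 : α N = 0 := by
        have := le_of_natCast_le (A := A) (n := 0) (by simpa using h1)
        omega
      rw [h2, Nat.cast_zero, Real.zero_rpow]
      positivity
    · obtain ⟨f, hf⟩ := exists_isSpectralPoint (A := A)
      refine ⟨⟨f, hf, hf.map_zero⟩, ?_⟩
      rintro _ ⟨g, hg, rfl⟩
      exact hg.nonneg 0
  have ha1 := one_le_of_ne_zero ha
  have hα1 : ∀ N, 1 ≤ α N := fun N => (hα N 1).1 (by simpa using one_le_pow' ha1 N)
  obtain ⟨K, hK⟩ := exists_le_natCast a
  have hαK : ∀ N, α N ≤ K ^ N := fun N => le_of_natCast_le (A := A) <| by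
    push_cast
    exact (hspec N).trans (pow_le_pow_left' hK N)
  have hmul : ∀ M N, α M * α N ≤ α (M + N) := fun M N => (hα _ _).1 <| by
    rw [Nat.cast_mul, pow_add]
    gcongr
    · exact hspec M
    · exact hspec N
  obtain ⟨L, hL0, hL, hlim⟩ := exists_tendsto_of_supermultiplicative hα1 hαK hmul
  refine ⟨_, hlim, ?_⟩
  have hlower : ∀ f : A → ℝ, IsSpectralPoint f → Real.exp L ≤ f a := by
    intro f hf
    refine le_of_tendsto hlim ?_
    filter_upwards [eventually_ge_atTop 1] with N hN
    have h1 := hf.mono _ _ (hspec N)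
    rw [hf.map_pow, hf.map_natCast] at h1
    have hN0 : N ≠ 0 := by omega
    rw [← pow_le_pow_iff_left₀ (by positivity) (hf.nonneg a) hN0,
      one_div, Real.rpow_inv_natCast_pow (Nat.cast_nonneg _) hN0]
    exact h1
  obtain ⟨f, hf, hfmin⟩ := isCompact_setOf_isSpectralPoint.exists_isMinOn
    (exists_isSpectralPoint (A := A)) (continuous_apply a).continuousOn
  refine ⟨⟨f, hf, le_antisymm ?_ (hlower f hf)⟩, ?_⟩
  swap
  · rintro _ ⟨g, hg, rfl⟩
    exact hlower g hg
  change f a ≤ Real.exp L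
  have hfpos : 0 < f a := lt_of_lt_of_le one_pos (hf.one_le ha)
  -- If `a ≤ 1` the minimum is at most 1. Otherwise `2 ≤ a`, so powers of `a` can absorb natural
  -- factors.
  rcases le_one_or_two_le a with ha' | ha2
  · have := hf.mono _ _ ha'
    rw [hf.map_one] at this
    exact this.trans (Real.one_le_exp hL0)
  rw [← Real.log_le_iff_le_exp hfpos]
  refine le_of_forall_mul_le_add (C := Real.log 2) fun N _ => ?_
  set n := ⌊f a ^ N⌋₊ with hn
  have hfN : 1 ≤ f a ^ N := one_le_pow₀ (hf.one_le ha)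
  have hn1 : 1 ≤ n := Nat.one_le_floor_iff _ |>.2 hfN
  have hn1' : (1 : ℝ) ≤ n := by exact_mod_cast hn1
  have hle : ∀ g : A → ℝ, IsSpectralPoint g → g n ≤ g (a ^ N) := by
    intro g hg
    rw [hg.map_natCast, hg.map_pow]
    have h1 : f a ≤ g a := hfmin hg
    exact (Nat.floor_le (by positivity)).trans (by gcongr)
  obtain ⟨x, hx, hxle⟩ := asympLE_iff.2 hle
  have hlogx : Tendsto (fun M : ℕ => Real.log (x M) / M) atTop (𝓝 0) := by
    have h1 := hx.log one_ne_zero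
    rw [Real.log_one] at h1
    refine h1.congr' ?_
    filter_upwards [hx.eventually (lt_mem_nhds one_half_lt_one), eventually_ge_atTop 1]
      with M hM hM1
    have hx0 : (0 : ℝ) < x M := by
      rcases Nat.eq_zero_or_pos (x M) with h0 | h0
      · rw [h0, Nat.cast_zero, Real.zero_rpow (by positivity)] at hM
        norm_num at hM
      · exact_mod_cast h0
    rw [Real.log_rpow hx0]
    ring
  have hlog2 : 0 < Real.log 2 := Real.log_pos (by norm_num)
  have key : ∀ M : ℕ, 1 ≤ M → Real.log n ≤
      N * L + (Real.log (x M) / M * (1 / Real.log 2) + 1 / M) * L := by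
    intro M hM
    -- Since `x M ≤ 2 ^ j ≤ a ^ j`, the subexponential factor costs only `j` extra powers of `a`,
    -- and `j / M` tends to 0.
    set j := Nat.clog 2 (x M) with hj
    have hM0 : (0 : ℝ) < M := by exact_mod_cast hM
    have h1 : ((n ^ M : ℕ) : A) ≤ a ^ (j + N * M) := by
      calc ((n ^ M : ℕ) : A) = (n : A) ^ M := by push_cast; rfl
        _ ≤ x M * (a ^ N) ^ M := hxle M
        _ ≤ a ^ j * (a ^ N) ^ M := by
          gcongr
          calc (x M : A) ≤ ((2 ^ j : ℕ) : A) :=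
                natCast_le_natCast (Nat.le_pow_clog (by norm_num) _)
            _ = 2 ^ j := by push_cast; rfl
            _ ≤ a ^ j := pow_le_pow_left' ha2 j
        _ = _ := by ring
    have h2 := (hα _ _).1 h1
    have h3 : M * Real.log n ≤ (j + N * M : ℕ) * L := by
      refine le_trans ?_ (hL _)
      rw [← Real.log_pow]
      exact Real.log_le_log (by positivity) (by exact_mod_cast h2)
    have h4 : (j : ℝ) ≤ Real.log (x M) * (1 / Real.log 2) + 1 := by
      rw [hj, ← Real.natCeil_logb_natCast, mul_one_div]
      have hx0 := Real.log_natCast_nonneg (x M)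
      exact (Nat.ceil_lt_add_one (div_nonneg hx0 (by exact_mod_cast hlog2.le))).le
    have h5 : M * Real.log n ≤ M *
        (N * L + (Real.log (x M) / M * (1 / Real.log 2) + 1 / M) * L) := by
      calc M * Real.log n ≤ (j + N * M : ℕ) * L := h3
        _ = N * M * L + j * L := by push_cast; ring
        _ ≤ N * M * L + (Real.log (x M) * (1 / Real.log 2) + 1) * L := by gcongr
        _ = _ := by field_simp
    exact le_of_mul_le_mul_left h5 hM0
  have hlog_n : Real.log n ≤ N * L := by
    have h1 : Tendsto (fun M : ℕ => N * L +
        (Real.log (x M) / M * (1 / Real.log 2) + 1 / M) * L) atTop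
        (𝓝 (N * L + (0 * (1 / Real.log 2) + 0) * L)) :=
      (((hlogx.mul_const _).add tendsto_one_div_atTop_nhds_zero_nat).mul_const _).const_add _
    simp only [zero_mul, add_zero] at h1
    refine ge_of_tendsto h1 ?_
    filter_upwards [eventually_ge_atTop 1] with M hM using key M hM
  have h6 : f a ^ N ≤ 2 * n := by
    have := Nat.lt_floor_add_one (f a ^ N)
    linarith
  calc N * Real.log (f a) = Real.log (f a ^ N) := by rw [Real.log_pow]
    _ ≤ Real.log (2 * n) := Real.log_le_log (by positivity) h6
    _ = Real.log 2 + Real.log n := Real.log_mul (by norm_num) (by positivity)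
    _ ≤ _ := by gcongr

end GraphLikeSemiring

/-! ### The semiring of graphs up to cohomomorphic equivalence -/

namespace FinGraph

/-- The reflexive closure of adjacency. -/
def Touch (G : FinGraph.{u}) (x y : G.V) : Prop := x = y ∨ G.graph.Adj x y

/-- Contraposition removes the complements: a map preserves being distinct and nonadjacent iff it
reflects `Touch`, a relation that is componentwise on strong products. -/
theorem cohomLE_iff {G H : FinGraph.{u}} :
    CohomLE G H ↔ ∃ f : G.V → H.V, ∀ x y, H.Touch (f x) (f y) → G.Touch x y := by
  constructor
  · rintro ⟨f⟩
    refine ⟨f, fun x y h => ?_⟩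
    by_contra hxy
    rw [Touch, not_or] at hxy
    have := f.map_rel ((SimpleGraph.compl_adj _ _ _).2 hxy)
    rw [SimpleGraph.compl_adj] at this
    exact h.elim this.1 this.2
  · rintro ⟨f, hf⟩
    refine ⟨⟨f, fun {x y} hxy => ?_⟩⟩
    rw [SimpleGraph.compl_adj] at hxy ⊢
    refine ⟨fun h => ?_, fun h => ?_⟩
    · exact (hf x y (Or.inl h)).elim hxy.1 hxy.2
    · exact (hf x y (Or.inr h)).elim hxy.1 hxy.2

theorem touch_strongProd {G H : FinGraph.{u}} (x y : G.V × H.V) :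
    (strongProd G H).Touch x y ↔ G.Touch x.1 y.1 ∧ H.Touch x.2 y.2 := by
  simp only [Touch, strongProd, Prod.ext_iff]
  tauto

theorem touch_disjUnion {G H : FinGraph.{u}} (x y : G.V ⊕ H.V) :
    (disjUnion G H).Touch x y ↔ Sum.LiftRel G.Touch H.Touch x y := by
  rcases x with x | x <;> rcases y with y | y <;> simp [Touch, disjUnion]

instance : Preorder FinGraph.{u} where
  le := CohomLE
  le_refl G := ⟨SimpleGraph.Hom.id⟩
  le_trans _ _ _ := fun ⟨f⟩ ⟨g⟩ => ⟨g.comp f⟩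

theorem le_iff {G H : FinGraph.{u}} :
    G ≤ H ↔ ∃ f : G.V → H.V, ∀ x y, H.Touch (f x) (f y) → G.Touch x y := cohomLE_iff

/-- The graph on `n` vertices without edges. -/
def discrete (n : ℕ) : FinGraph.{u} where
  V := ULift.{u} (Fin n)
  graph := ⊥

theorem touch_discrete {n : ℕ} (x y : ULift.{u} (Fin n)) : (discrete n).Touch x y ↔ x = y := by
  simp [Touch, discrete]

instance : IsEmpty (K.{u} 0).V := inferInstanceAs (IsEmpty (ULift (Fin 0)))

instance : Unique (K.{u} 1).V := inferInstanceAs (Unique (ULift (Fin 1)))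

theorem touch_K_one (x y : (K.{u} 1).V) : (K.{u} 1).Touch x y :=
  Or.inl (Subsingleton.elim x y)

/-- The reflexive closure of adjacency of `G` is isomorphic to the relation `r` on `α`. -/
def Models (G : FinGraph.{u}) {α : Type u} (r : α → α → Prop) : Prop :=
  ∃ e : G.V ≃ α, ∀ x y, r (e x) (e y) ↔ G.Touch x y

/-- The componentwise relation on a product. -/
def ProdRel {α β : Type u} (r : α → α → Prop) (s : β → β → Prop) (x y : α × β) : Prop :=
  r x.1 y.1 ∧ s x.2 y.2

theorem models_self (G : FinGraph.{u}) : G.Models G.Touch := ⟨Equiv.refl _, fun _ _ => Iff.rfl⟩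

theorem models_discrete (n : ℕ) :
    (discrete.{u} n).Models (fun x y : ULift.{u} (Fin n) => x = y) :=
  ⟨Equiv.refl _, fun x y => (touch_discrete x y).symm⟩

theorem models_K_one : (K.{u} 1).Models (fun _ _ : PUnit.{u + 1} => True) :=
  ⟨Equiv.ofUnique _ _, fun x y => iff_of_true trivial (touch_K_one x y)⟩

theorem models_K_zero : (K.{u} 0).Models (fun _ _ : PEmpty.{u + 1} => True) :=
  ⟨Equiv.equivOfIsEmpty _ _, fun x => isEmptyElim x⟩

section Models

variable {G H : FinGraph.{u}} {α β : Type u} {r : α → α → Prop} {s : β → β → Prop}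

theorem Models.disjUnion (hG : G.Models r) (hH : H.Models s) :
    (disjUnion G H).Models (Sum.LiftRel r s) := by
  obtain ⟨e, he⟩ := hG
  obtain ⟨e', he'⟩ := hH
  refine ⟨Equiv.sumCongr e e', fun x y => Iff.trans ?_ (touch_disjUnion x y).symm⟩
  rcases x with x | x <;> rcases y with y | y
  · exact Sum.liftRel_inl_inl.trans ((he x y).trans Sum.liftRel_inl_inl.symm)
  · exact iff_of_false Sum.not_liftRel_inl_inr Sum.not_liftRel_inl_inr
  · exact iff_of_false Sum.not_liftRel_inr_inl Sum.not_liftRel_inr_inl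
  · exact Sum.liftRel_inr_inr.trans ((he' x y).trans Sum.liftRel_inr_inr.symm)

theorem Models.strongProd (hG : G.Models r) (hH : H.Models s) :
    (strongProd G H).Models (ProdRel r s) := by
  obtain ⟨e, he⟩ := hG
  obtain ⟨e', he'⟩ := hH
  refine ⟨Equiv.prodCongr e e', fun x y => Iff.trans ?_ (touch_strongProd x y).symm⟩
  exact and_congr (he x.1 y.1) (he' x.2 y.2)

theorem Models.le (hG : G.Models r) (hH : H.Models s) (e : α ≃ β)
    (h : ∀ x y, s (e x) (e y) ↔ r x y) : G ≤ H := by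
  obtain ⟨f, hf⟩ := hG
  obtain ⟨g, hg⟩ := hH
  refine le_iff.2 ⟨fun x => g.symm (e (f x)), fun x y hxy => ?_⟩
  rw [← hg, g.apply_symm_apply, g.apply_symm_apply, h, hf] at hxy
  exact hxy

theorem Models.antisymmRel (hG : G.Models r) (hH : H.Models s) (e : α ≃ β)
    (h : ∀ x y, s (e x) (e y) ↔ r x y) : AntisymmRel (· ≤ ·) G H :=
  ⟨hG.le hH e h, hH.le hG e.symm fun x y => by simp [← h]⟩

end Models

theorem disjUnion_le_disjUnion {G G' H H' : FinGraph.{u}} (h : G ≤ G') (h' : H ≤ H') :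
    disjUnion G H ≤ disjUnion G' H' := by
  obtain ⟨f, hf⟩ := le_iff.1 h
  obtain ⟨g, hg⟩ := le_iff.1 h'
  refine le_iff.2 ⟨Sum.map f g, fun x y hxy => ?_⟩
  refine (touch_disjUnion x y).2 ?_
  replace hxy := (touch_disjUnion _ _).1 hxy
  rcases x with x | x <;> rcases y with y | y <;>
    simp only [Sum.map_inl, Sum.map_inr, Sum.liftRel_inl_inl, Sum.liftRel_inr_inr,
      Sum.not_liftRel_inl_inr, Sum.not_liftRel_inr_inl] at hxy ⊢
  · exact hf _ _ hxy
  · exact hg _ _ hxy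

theorem strongProd_le_strongProd {G G' H H' : FinGraph.{u}} (h : G ≤ G') (h' : H ≤ H') :
    strongProd G H ≤ strongProd G' H' := by
  obtain ⟨f, hf⟩ := le_iff.1 h
  obtain ⟨g, hg⟩ := le_iff.1 h'
  refine le_iff.2 ⟨Prod.map f g, fun x y hxy => ?_⟩
  replace hxy := (touch_strongProd _ _).1 hxy
  exact (touch_strongProd x y).2 ⟨hf _ _ hxy.1, hg _ _ hxy.2⟩

theorem le_of_isEmpty {G : FinGraph.{u}} (hG : IsEmpty G.V) (H : FinGraph.{u}) : G ≤ H :=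
  le_iff.2 ⟨isEmptyElim, fun x => isEmptyElim x⟩

theorem K_one_le {G : FinGraph.{u}} (x : G.V) : K 1 ≤ G :=
  le_iff.2 ⟨fun _ => x, fun a b _ => touch_K_one a b⟩

/-- A map from an edgeless graph that reflects `Touch` is injective with independent image. -/
theorem discrete_le_iff {n : ℕ} {G : FinGraph.{u}} :
    discrete n ≤ G ↔ n ≤ G.graph.indepNum := by
  classical
  have := Fintype.ofFinite G.V
  rw [le_iff]
  constructor
  · rintro ⟨f, hf⟩
    have hf' : ∀ x y, G.Touch (f x) (f y) → x = y := fun x y h =>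
      (touch_discrete x y).1 (hf x y h)
    have hinj : Function.Injective f := fun x y h => hf' x y (Or.inl h)
    let s : Finset G.V := Finset.univ.map
      (⟨fun i : Fin n => f (ULift.up i), hinj.comp ULift.up_injective⟩ : Fin n ↪ G.V)
    have hs : G.graph.IsIndepSet s := by
      intro a ha b hb hab hadj
      simp only [s, Finset.coe_map, Function.Embedding.coeFn_mk, Finset.coe_univ, Set.image_univ,
        Set.mem_range] at ha hb
      obtain ⟨i, rfl⟩ := ha
      obtain ⟨j, rfl⟩ := hb
      exact hab (congrArg f (hf' _ _ (Or.inr hadj)))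
    have := hs.card_le_indepNum
    simpa [s] using this
  · intro h
    obtain ⟨s, hs⟩ := G.graph.exists_isNIndepSet_indepNum
    have hcard : n ≤ s.card := by rw [hs.card_eq]; exact h
    let e : Fin n ↪ s := (Fin.castLEEmb hcard).trans s.equivFin.symm.toEmbedding
    refine ⟨fun i => (e i.down).1, fun x y hxy => ?_⟩
    refine (touch_discrete x y).2 ?_
    have : (e x.down).1 = (e y.down).1 := by
      by_contra hne
      rcases hxy with h1 | h1
      · exact hne h1
      · exact hs.isIndepSet (e x.down).2 (e y.down).2 hne h1
    exact ULift.down_injective (e.injective (Subtype.ext this))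

/-- Graphs up to cohomomorphic equivalence. -/
abbrev GraphClass : Type (u + 1) := Antisymmetrization FinGraph.{u} (· ≤ ·)

/-- The class of a graph. -/
def toClass (G : FinGraph.{u}) : GraphClass.{u} := toAntisymmetrization (· ≤ ·) G

theorem toClass_le_toClass {G H : FinGraph.{u}} : toClass G ≤ toClass H ↔ CohomLE G H := Iff.rfl

/-- Most semiring axioms below reduce through this to a standard equivalence of sums or products of
types that respects the relations. -/
theorem Models.toClass_eq {G H : FinGraph.{u}} {α β : Type u} {r : α → α → Prop}
    {s : β → β → Prop} (hG : G.Models r) (hH : H.Models s) (e : α ≃ β)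
    (h : ∀ x y, s (e x) (e y) ↔ r x y) : toClass G = toClass H :=
  Quotient.sound (hG.antisymmRel hH e h)

theorem toClass_surjective (q : GraphClass.{u}) : ∃ G, toClass G = q := Quotient.exists_rep q

instance : Add GraphClass.{u} :=
  ⟨Quotient.map₂ disjUnion fun _ _ h _ _ h' =>
    ⟨disjUnion_le_disjUnion h.1 h'.1, disjUnion_le_disjUnion h.2 h'.2⟩⟩

instance : Mul GraphClass.{u} :=
  ⟨Quotient.map₂ strongProd fun _ _ h _ _ h' =>
    ⟨strongProd_le_strongProd h.1 h'.1, strongProd_le_strongProd h.2 h'.2⟩⟩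

instance : Zero GraphClass.{u} := ⟨toClass (K 0)⟩

instance : One GraphClass.{u} := ⟨toClass (K 1)⟩

theorem toClass_disjUnion (G H : FinGraph.{u}) : toClass (disjUnion G H) = toClass G + toClass H := rfl

theorem toClass_strongProd (G H : FinGraph.{u}) : toClass (strongProd G H) = toClass G * toClass H := rfl

theorem toClass_K_zero : toClass (K.{u} 0) = 0 := rfl

theorem toClass_K_one : toClass (K.{u} 1) = 1 := rfl

theorem toClass_add_comm (a b : GraphClass.{u}) : a + b = b + a := by
  obtain ⟨G, rfl⟩ := toClass_surjective a
  obtain ⟨H, rfl⟩ := toClass_surjective b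
  have hG := models_self G
  have hH := models_self H
  refine (hG.disjUnion hH).toClass_eq (hH.disjUnion hG) (Equiv.sumComm _ _) ?_
  rintro (x | x) (y | y) <;> simp

theorem toClass_mul_comm (a b : GraphClass.{u}) : a * b = b * a := by
  obtain ⟨G, rfl⟩ := toClass_surjective a
  obtain ⟨H, rfl⟩ := toClass_surjective b
  have hG := models_self G
  have hH := models_self H
  refine (hG.strongProd hH).toClass_eq (hH.strongProd hG) (Equiv.prodComm _ _) ?_
  simp [ProdRel, and_comm]

theorem toClass_add_assoc (a b c : GraphClass.{u}) : a + b + c = a + (b + c) := by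
  obtain ⟨G, rfl⟩ := toClass_surjective a
  obtain ⟨H, rfl⟩ := toClass_surjective b
  obtain ⟨J, rfl⟩ := toClass_surjective c
  have hG := models_self G
  have hH := models_self H
  have hJ := models_self J
  refine ((hG.disjUnion hH).disjUnion hJ).toClass_eq (hG.disjUnion (hH.disjUnion hJ))
    (Equiv.sumAssoc _ _ _) ?_
  rintro ((x | x) | x) ((y | y) | y) <;> simp

theorem toClass_mul_assoc (a b c : GraphClass.{u}) : a * b * c = a * (b * c) := by
  obtain ⟨G, rfl⟩ := toClass_surjective a
  obtain ⟨H, rfl⟩ := toClass_surjective b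
  obtain ⟨J, rfl⟩ := toClass_surjective c
  have hG := models_self G
  have hH := models_self H
  have hJ := models_self J
  refine ((hG.strongProd hH).strongProd hJ).toClass_eq (hG.strongProd (hH.strongProd hJ))
    (Equiv.prodAssoc _ _ _) ?_
  simp [ProdRel, and_assoc]

theorem toClass_add_mul (a b c : GraphClass.{u}) : (a + b) * c = a * c + b * c := by
  obtain ⟨G, rfl⟩ := toClass_surjective a
  obtain ⟨H, rfl⟩ := toClass_surjective b
  obtain ⟨J, rfl⟩ := toClass_surjective c
  have hG := models_self G
  have hH := models_self H
  have hJ := models_self J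
  refine ((hG.disjUnion hH).strongProd hJ).toClass_eq
    ((hG.strongProd hJ).disjUnion (hH.strongProd hJ)) (Equiv.sumProdDistrib _ _ _) ?_
  rintro ⟨x | x, x'⟩ ⟨y | y, y'⟩ <;> simp [ProdRel]

theorem toClass_zero_add (a : GraphClass.{u}) : 0 + a = a := by
  obtain ⟨G, rfl⟩ := toClass_surjective a
  refine (models_K_zero.disjUnion (models_self G)).toClass_eq (models_self G)
    (Equiv.emptySum _ _) ?_
  rintro (x | x) (y | y)
  · exact isEmptyElim x
  · exact isEmptyElim x
  · exact isEmptyElim y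
  · simp

theorem toClass_one_mul (a : GraphClass.{u}) : 1 * a = a := by
  obtain ⟨G, rfl⟩ := toClass_surjective a
  refine (models_K_one.strongProd (models_self G)).toClass_eq (models_self G)
    (Equiv.punitProd _) ?_
  simp [ProdRel]

theorem toClass_zero_mul (a : GraphClass.{u}) : 0 * a = 0 := by
  obtain ⟨G, rfl⟩ := toClass_surjective a
  have : IsEmpty (strongProd (K.{u} 0) G).V := inferInstanceAs (IsEmpty ((K.{u} 0).V × G.V))
  exact le_antisymm (toClass_le_toClass.2 (le_of_isEmpty this _))
    (toClass_le_toClass.2 (le_of_isEmpty inferInstance _))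

instance : CommSemiring GraphClass.{u} where
  add_assoc := toClass_add_assoc
  add_comm := toClass_add_comm
  zero_add := toClass_zero_add
  add_zero a := by rw [toClass_add_comm, toClass_zero_add]
  nsmul := nsmulRec
  mul_assoc := toClass_mul_assoc
  mul_comm := toClass_mul_comm
  one_mul := toClass_one_mul
  mul_one a := by rw [toClass_mul_comm, toClass_one_mul]
  zero_mul := toClass_zero_mul
  mul_zero a := by rw [toClass_mul_comm, toClass_zero_mul]
  right_distrib := toClass_add_mul
  left_distrib a b c := by
    rw [toClass_mul_comm, toClass_add_mul, toClass_mul_comm b, toClass_mul_comm c]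

theorem toClass_copies (G : FinGraph.{u}) (n : ℕ) : toClass (G.copies n) = n * toClass G := by
  induction n with
  | zero => rw [copies, toClass_K_zero, Nat.cast_zero, zero_mul]
  | succ n ih => rw [copies, toClass_disjUnion, ih, Nat.cast_succ, add_mul, one_mul]

theorem toClass_strongPow (G : FinGraph.{u}) (n : ℕ) : toClass (G.strongPow n) = toClass G ^ n := by
  induction n with
  | zero => rw [strongPow, toClass_K_one, pow_zero]
  | succ n ih => rw [strongPow, toClass_strongProd, ih, pow_succ]

theorem toClass_discrete (n : ℕ) : toClass (discrete.{u} n) = n := by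
  induction n with
  | zero =>
    rw [Nat.cast_zero]
    have : IsEmpty (discrete.{u} 0).V := inferInstanceAs (IsEmpty (ULift (Fin 0)))
    exact le_antisymm (toClass_le_toClass.2 (le_of_isEmpty this _))
      (toClass_le_toClass.2 (le_of_isEmpty inferInstance _))
  | succ n ih =>
    rw [Nat.cast_succ, ← ih, ← toClass_K_one, ← toClass_disjUnion]
    let e : ULift.{u} (Fin (n + 1)) ≃ ULift.{u} (Fin n) ⊕ PUnit.{u + 1} :=
      Equiv.ulift.trans (finSumFinEquiv.symm.trans
        (Equiv.sumCongr Equiv.ulift.symm (Equiv.ofUnique _ _)))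
    refine (models_discrete (n + 1)).toClass_eq ((models_discrete n).disjUnion models_K_one) e ?_
    intro x y
    rw [← e.injective.eq_iff]
    rcases e x with a | a <;> rcases e y with b | b <;> simp

theorem natCast_le_toClass_iff {n : ℕ} {G : FinGraph.{u}} :
    (n : GraphClass.{u}) ≤ toClass G ↔ n ≤ G.graph.indepNum := by
  rw [← toClass_discrete, toClass_le_toClass]
  exact discrete_le_iff

instance : GraphLikeSemiring GraphClass.{u} where
  add_le_add_left' {a b} h c := by
    obtain ⟨G, rfl⟩ := toClass_surjective a
    obtain ⟨H, rfl⟩ := toClass_surjective b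
    obtain ⟨J, rfl⟩ := toClass_surjective c
    exact toClass_le_toClass.2 (disjUnion_le_disjUnion le_rfl h)
  mul_le_mul_left' {a b} h c := by
    obtain ⟨G, rfl⟩ := toClass_surjective a
    obtain ⟨H, rfl⟩ := toClass_surjective b
    obtain ⟨J, rfl⟩ := toClass_surjective c
    exact toClass_le_toClass.2 (strongProd_le_strongProd le_rfl h)
  zero_le' a := by
    obtain ⟨G, rfl⟩ := toClass_surjective a
    exact toClass_le_toClass.2 (le_of_isEmpty inferInstance G)
  exists_le_natCast a := by
    obtain ⟨G, rfl⟩ := toClass_surjective a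
    refine ⟨Nat.card G.V, ?_⟩
    rw [← toClass_discrete]
    refine le_iff.2 ⟨fun x => ULift.up (Finite.equivFin G.V x), fun x y h => Or.inl ?_⟩
    exact (Finite.equivFin G.V).injective (ULift.up_injective ((touch_discrete _ _).1 h))
  one_le_of_ne_zero {a} h := by
    obtain ⟨G, rfl⟩ := toClass_surjective a
    rcases isEmpty_or_nonempty G.V with hG | ⟨⟨x⟩⟩
    · exact absurd (le_antisymm (toClass_le_toClass.2 (le_of_isEmpty hG _))
        (toClass_le_toClass.2 (le_of_isEmpty inferInstance _))) h
    · exact toClass_le_toClass.2 (K_one_le x)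
  le_of_natCast_le {m n} h := by
    rw [← toClass_discrete, ← toClass_discrete] at h
    obtain ⟨f, hf⟩ := le_iff.1 h
    have hinj : Function.Injective f := fun x y hxy => (touch_discrete x y).1 (hf x y (Or.inl hxy))
    have := Nat.card_le_card_of_injective (α := ULift.{u} (Fin m)) (β := ULift.{u} (Fin n)) f hinj
    simpa using this
  le_one_or_two_le a := by
    obtain ⟨G, rfl⟩ := toClass_surjective a
    -- Either any two vertices touch and everything maps to a single vertex, or two untouching
    -- vertices form a copy of the edgeless graph on two vertices.
    by_cases h : ∀ x y, G.Touch x y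
    · exact Or.inl (toClass_le_toClass.2 (le_iff.2 ⟨fun _ => default, fun x y _ => h x y⟩))
    · right
      push Not at h
      obtain ⟨x, y, hxy⟩ := h
      have hyx : ¬ G.Touch y x := fun hyx => hxy (hyx.imp Eq.symm fun h => h.symm)
      have h2 : (2 : GraphClass.{u}) = toClass (discrete 2) := by rw [toClass_discrete]; rfl
      rw [h2]
      refine le_iff.2 ⟨fun i : ULift.{u} (Fin 2) => if i.down = 0 then x else y, ?_⟩
      rintro ⟨i⟩ ⟨j⟩ hij
      refine (touch_discrete _ _).2 ?_
      fin_cases i <;> fin_cases j <;> simp_all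

end FinGraph

/-! ### Closed collections as subsemirings -/

namespace GraphLikeSemiring

instance {A : Type*} [CommSemiring A] [PartialOrder A] [GraphLikeSemiring A]
    (R : Subsemiring A) : GraphLikeSemiring R where
  add_le_add_left' h c := add_le_add_left' (A := A) h c
  mul_le_mul_left' h c := mul_le_mul_left' (A := A) h c
  zero_le' a := zero_le' (a : A)
  exists_le_natCast a := exists_le_natCast (a : A)
  one_le_of_ne_zero {a} h := one_le_of_ne_zero (a := (a : A)) (by simpa using h)
  le_of_natCast_le h := le_of_natCast_le (A := A) h
  le_one_or_two_le a := le_one_or_two_le (a : A)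

end GraphLikeSemiring

namespace FinGraph

open GraphLikeSemiring

variable {S : Set FinGraph.{u}} (hS : IsClosedCollection S)

/-- The semiring of classes of graphs of a closed collection, with zero added. -/
def classSubsemiring (hS : IsClosedCollection S) : Subsemiring GraphClass.{u} where
  carrier := {q | q = 0 ∨ ∃ G ∈ S, toClass G = q}
  zero_mem' := Or.inl rfl
  one_mem' := Or.inr ⟨_, hS.K_one_mem, rfl⟩
  add_mem' := by
    rintro a b (rfl | ⟨G, hG, rfl⟩) (rfl | ⟨H, hH, rfl⟩)
    · exact Or.inl (add_zero _)
    · exact Or.inr ⟨H, hH, (zero_add _).symm⟩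
    · exact Or.inr ⟨G, hG, (add_zero _).symm⟩
    · exact Or.inr ⟨_, hS.disjUnion_mem hG hH, rfl⟩
  mul_mem' := by
    rintro a b (rfl | ⟨G, hG, rfl⟩) (rfl | ⟨H, hH, rfl⟩)
    · exact Or.inl (zero_mul _)
    · exact Or.inl (zero_mul _)
    · exact Or.inl (mul_zero _)
    · exact Or.inr ⟨_, hS.strongProd_mem hG hH, rfl⟩

/-- The class of a member of a closed collection. -/
def classOf (hS : IsClosedCollection S) (G : S) : classSubsemiring hS :=
  ⟨toClass G.1, Or.inr ⟨G.1, G.2, rfl⟩⟩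

theorem eq_zero_or_exists_classOf (q : classSubsemiring hS) :
    q = 0 ∨ ∃ G : S, classOf hS G = q := by
  obtain ⟨q, rfl | ⟨G, hG, rfl⟩⟩ := q
  · exact Or.inl rfl
  · exact Or.inr ⟨⟨G, hG⟩, rfl⟩

theorem classOf_le_iff {G H : S} : classOf hS G ≤ classOf hS H ↔ CohomLE G.1 H.1 := Iff.rfl

theorem classOf_disjUnion (G H : S) :
    classOf hS ⟨disjUnion G.1 H.1, hS.disjUnion_mem G.2 H.2⟩ = classOf hS G + classOf hS H := rfl

theorem classOf_strongProd (G H : S) :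
    classOf hS ⟨strongProd G.1 H.1, hS.strongProd_mem G.2 H.2⟩ = classOf hS G * classOf hS H := rfl

theorem classOf_K_one : classOf hS ⟨K 1, hS.K_one_mem⟩ = 1 := rfl

theorem exists_mem_asymptoticSpectrum {f : classSubsemiring hS → ℝ} (hf : IsSpectralPoint f) :
    ∃ φ ∈ asymptoticSpectrum S hS, ∀ G, (φ G : ℝ) = f (classOf hS G) := by
  refine ⟨fun G => ⟨f (classOf hS G), hf.nonneg _⟩, ⟨?_, ?_, ?_, ?_⟩, fun G => rfl⟩
  · exact fun G H h => hf.mono _ _ h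
  · exact fun G H => NNReal.eq (hf.map_add (classOf hS G) (classOf hS H))
  · exact fun G H => NNReal.eq (hf.map_mul (classOf hS G) (classOf hS H))
  · exact NNReal.eq hf.map_one

/-- Monotonicity makes `φ` constant on classes. The extra point is the zero of the subsemiring,
which need not come from a member of `S`. -/
theorem exists_isSpectralPoint_eq {φ : S → ℝ≥0} (hφ : φ ∈ asymptoticSpectrum S hS) :
    ∃ f : classSubsemiring hS → ℝ, IsSpectralPoint f ∧ ∀ G, f (classOf hS G) = φ G := by
  classical
  obtain ⟨hmono, hadd, hmul, hone⟩ := hφ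
  have hcongr : ∀ G H : S, classOf hS G = classOf hS H → φ G = φ H := fun G H h =>
    le_antisymm (hmono _ _ (classOf_le_iff hS |>.1 h.le)) (hmono _ _ (classOf_le_iff hS |>.1 h.ge))
  let f : classSubsemiring hS → ℝ := fun q =>
    if h : ∃ G : S, classOf hS G = q then φ h.choose else 0
  have hf : ∀ G, f (classOf hS G) = φ G := by
    intro G
    have h : ∃ H : S, classOf hS H = classOf hS G := ⟨G, rfl⟩
    simp only [f, dif_pos h]
    rw [hcongr _ _ h.choose_spec]
  -- If a graph of `S` does represent zero, it is equivalent to its double, so additivity gives `φ G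
  -- = φ G + φ G`; otherwise the default value applies.
  have hzero : f 0 = 0 := by
    by_cases h : ∃ G : S, classOf hS G = 0
    · obtain ⟨G, hG⟩ := h
      rw [← hG, hf]
      have h1 := hadd G G
      rw [hcongr _ G (by rw [classOf_disjUnion, hG, add_zero])] at h1
      have h2 : (φ G : ℝ) = φ G + φ G := by exact_mod_cast h1
      linarith
    · simp only [f, dif_neg h]
  have hnonneg : ∀ q, 0 ≤ f q := by
    intro q
    rcases eq_zero_or_exists_classOf hS q with rfl | ⟨G, rfl⟩
    · exact hzero.ge
    · rw [hf]
      exact NNReal.coe_nonneg _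
  refine ⟨f, ⟨?_, ?_, ?_, ?_⟩, hf⟩
  · intro a b hab
    rcases eq_zero_or_exists_classOf hS a with rfl | ⟨G, rfl⟩
    · rw [hzero]
      exact hnonneg b
    rcases eq_zero_or_exists_classOf hS b with rfl | ⟨H, rfl⟩
    · rw [le_antisymm hab (zero_le' _)]
    · rw [hf, hf]
      exact_mod_cast hmono G H hab
  · intro a b
    rcases eq_zero_or_exists_classOf hS a with rfl | ⟨G, rfl⟩
    · rw [zero_add, hzero, zero_add]
    rcases eq_zero_or_exists_classOf hS b with rfl | ⟨H, rfl⟩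
    · rw [add_zero, hzero, add_zero]
    · rw [← classOf_disjUnion, hf, hf, hf, hadd, NNReal.coe_add]
  · intro a b
    rcases eq_zero_or_exists_classOf hS a with rfl | ⟨G, rfl⟩
    · rw [zero_mul, hzero, zero_mul]
    rcases eq_zero_or_exists_classOf hS b with rfl | ⟨H, rfl⟩
    · rw [mul_zero, hzero, mul_zero]
    · rw [← classOf_strongProd, hf, hf, hf, hmul, NNReal.coe_mul]
  · rw [← classOf_K_one, hf, hone, NNReal.coe_one]

theorem asympLE_iff_classOf (G H : S) :
    AsympLE G.1 H.1 ↔ GraphLikeSemiring.AsympLE (classOf hS G) (classOf hS H) := by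
  refine exists_congr fun x => and_congr_right fun _ => forall_congr' fun N => ?_
  rw [← toClass_le_toClass, toClass_copies, toClass_strongPow, toClass_strongPow]
  rfl

theorem natCast_le_classOf_pow_iff (G : S) (N n : ℕ) :
    (n : classSubsemiring hS) ≤ classOf hS G ^ N ↔ n ≤ (G.1.strongPow N).graph.indepNum := by
  rw [← natCast_le_toClass_iff, toClass_strongPow]
  rfl

end FinGraph

/-! ### Transfer of the duality to the collection -/

theorem theorem1p1 (S : Set FinGraph.{u}) (hS : FinGraph.IsClosedCollection S) :
    (∀ G H : S, FinGraph.AsympLE G.1 H.1 ↔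
      ∀ φ ∈ FinGraph.asymptoticSpectrum S hS, φ G ≤ φ H) ∧
    (∀ G : S,
      Tendsto G.1.capacitySeq atTop (𝓝 G.1.shannonCapacity) ∧
      IsLeast ((fun φ : S → ℝ≥0 => (φ G : ℝ)) '' FinGraph.asymptoticSpectrum S hS)
        G.1.shannonCapacity) := by
  refine ⟨fun G H => ?_, fun G => ?_⟩
  · rw [FinGraph.asympLE_iff_classOf hS, GraphLikeSemiring.asympLE_iff]
    constructor
    · intro h φ hφ
      obtain ⟨f, hf, hfφ⟩ := FinGraph.exists_isSpectralPoint_eq hS hφ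
      have := h f hf
      rw [hfφ, hfφ] at this
      exact_mod_cast this
    · intro h f hf
      obtain ⟨φ, hφ, hfφ⟩ := FinGraph.exists_mem_asymptoticSpectrum hS hf
      rw [← hfφ, ← hfφ]
      exact_mod_cast h φ hφ
  · obtain ⟨Θ, hlim, hleast⟩ := GraphLikeSemiring.exists_tendsto_isLeast
      (FinGraph.natCast_le_classOf_pow_iff hS G)
    -- The value of `limUnder` is meaningful only once convergence is known, which `hlim` provides.
    have hΘ : G.1.shannonCapacity = Θ := Tendsto.limUnder_eq hlim
    rw [hΘ]
    refine ⟨hlim, ?_⟩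
    convert hleast using 1
    ext t
    constructor
    · rintro ⟨φ, hφ, rfl⟩
      obtain ⟨f, hf, hfφ⟩ := FinGraph.exists_isSpectralPoint_eq hS hφ
      exact ⟨f, hf, hfφ G⟩
    · rintro ⟨f, hf, rfl⟩
      obtain ⟨φ, hφ, hfφ⟩ := FinGraph.exists_mem_asymptoticSpectrum hS hf
      exact ⟨φ, hφ, hfφ G⟩
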